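/- Let \(T\) be a complete first-order theory with NIP (no formula \(\varphi(\bar x,\bar y)\) has the independence property), let \(|T|\) be the number of formulas of its language (so \(|T|\ge\aleph_0\)), and let \(\mathfrak C\) be its monster model (or any model of \(T\)). Let \(I_1,I_2\) be linear orders without last element and of cofinality \(>|T|\), and let \(\bar{\mathbf a}^\ell=\langle\bar a^\ell_t:t\in I_\ell\rangle\) for \(\ell=1,2\) be sequences of \(m_\ell\)-tuples of \(\mathfrak C\), \(m_\ell<\omega\). For \(A\subseteq\mathfrak C\), two such sequences are called mutually indiscernible over \(A\) if each of them is an indiscernible sequence over the union of \(A\) and the set of all entries of the other one; "mutually indiscernible" means mutually indiscernible over \(\emptyset\). Suppose that \(\bar{\mathbf a}^1,\bar{\mathbf a}^2\) are mutually indiscernible. Then for every finite tuple \(\bar b\) of \(\mathfrak C\) there are end segments (nonempty upward closed subsets) \(J_1\) of \(I_1\) and \(J_2\) of \(I_2\) such that \(\bar{\mathbf a}^1\restriction J_1\) and \(\bar{\mathbf a}^2\restriction J_2\) are mutually indiscernible over \(\bar b\). -/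

import Mathlib

open FirstOrder Cardinal

universe u v w x y

namespace NIPSeq

section Theory

variable {L : FirstOrder.Language.{u, v}}

/-- The number `|T|` of first-order formulas in the language of a theory `T`,
i.e. the number of non-logical symbols plus `ℵ₀`. -/
noncomputable def theoryCard (_T : L.Theory) : Cardinal.{max u v} := max ℵ₀ L.card

/-- The sentence
`∃ y₀ … y_{n-1}, ⋀_{η : n → 2} ∃ x, ⋀_{l < n} φ(x, y_l)^{η(l)}`
attached to `φ(x, y)`, where `x` is a `k`-tuple and the `y_l` are `m`-tuples. -/
noncomputable def ipSentence {k m : ℕ} (φ : L.Formula (Fin k ⊕ Fin m)) (n : ℕ) : L.Sentence :=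
  let inst (l : Fin n) : L.Formula ((Fin n × Fin m) ⊕ Fin k) :=
    φ.relabel (Sum.elim Sum.inr fun j => Sum.inl (l, j))
  let body : L.Formula (Fin n × Fin m) :=
    FirstOrder.Language.Formula.iInf fun η : Fin n → Bool =>
      FirstOrder.Language.Formula.iExs (Fin k) <|
        FirstOrder.Language.Formula.iInf fun l : Fin n => if η l then inst l else (inst l).not
  FirstOrder.Language.Formula.iExs (Fin n × Fin m) (body.relabel (Sum.inr : _ → Empty ⊕ (Fin n × Fin m)))

/-- `ipSentence φ n` says what it should. -/
theorem realize_ipSentence {M : Type w} [L.Structure M] {k m : ℕ}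
    (φ : L.Formula (Fin k ⊕ Fin m)) (n : ℕ) :
    M ⊨ ipSentence φ n ↔
      ∃ y : Fin n → Fin m → M, ∀ η : Fin n → Bool, ∃ x : Fin k → M,
        ∀ l : Fin n, φ.Realize (Sum.elim x (y l)) ↔ η l = true := by
  have key : ∀ (y : Fin n × Fin m → M) (x : Fin k → M) (l : Fin n),
      (Sum.elim y x ∘ Sum.elim Sum.inr fun j => Sum.inl (l, j)) =
        (Sum.elim x fun j => y (l, j)) := by
    intro y x l
    funext s
    rcases s with s | s <;> rfl
  simp only [ipSentence, FirstOrder.Language.Sentence.Realize, FirstOrder.Language.Formula.realize_iExs,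
    FirstOrder.Language.Formula.realize_relabel, FirstOrder.Language.Formula.realize_iInf, Sum.elim_comp_inr]
  have aux : ∀ (y : Fin n × Fin m → M) (x : Fin k → M) (η : Fin n → Bool) (l : Fin n),
      ((if η l then φ.relabel (Sum.elim Sum.inr fun j => Sum.inl (l, j))
        else (φ.relabel (Sum.elim Sum.inr fun j => Sum.inl (l, j))).not :
          L.Formula ((Fin n × Fin m) ⊕ Fin k)).Realize (Sum.elim y x)) ↔
      (φ.Realize (Sum.elim x fun j => y (l, j)) ↔ η l = true) := by
    intro y x η l
    cases h : η l <;>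
      simp [FirstOrder.Language.Formula.realize_not, FirstOrder.Language.Formula.realize_relabel, key]
  constructor
  · rintro ⟨y, hy⟩
    refine ⟨fun l j => y (l, j), fun η => ?_⟩
    obtain ⟨x, hx⟩ := hy η
    exact ⟨x, fun l => (aux y x η l).1 (hx l)⟩
  · rintro ⟨y, hy⟩
    refine ⟨fun p => y p.1 p.2, fun η => ?_⟩
    obtain ⟨x, hx⟩ := hy η
    exact ⟨x, fun l => (aux _ x η l).2 (hx l)⟩

/-- `T` is NIP: there is no formula `φ(x, y)` such that, for every `n`, `T` proves that
some `y₀, …, y_{n-1}` are shattered by `φ`.  (Used for complete theories `T`.) -/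
def IsNIP (T : L.Theory) : Prop :=
  ¬ ∃ (k m : ℕ) (φ : L.Formula (Fin k ⊕ Fin m)), ∀ n : ℕ, T ⊨ᵇ ipSentence φ n

end Theory

section Sequences

variable (L : FirstOrder.Language.{u, v}) {M : Type w} [L.Structure M]

/-- The set of all coordinates of the members of a sequence of `m`-tuples. -/
def entries {I : Type*} {m : ℕ} (a : I → Fin m → M) : Set M :=
  {x | ∃ t j, a t j = x}

/-- The sequence `⟨a_t : t ∈ I⟩` of `m`-tuples is indiscernible over `A`: for all `n`, all
`s₀ < … < s_{n-1}` and `t₀ < … < t_{n-1}` in `I`, the tuples `a_{s₀} … a_{s_{n-1}}` and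
`a_{t₀} … a_{t_{n-1}}` satisfy the same formulas with parameters from `A`. -/
def IndiscernibleOver {I : Type*} [LinearOrder I] {m : ℕ} (A : Set M)
    (a : I → Fin m → M) : Prop :=
  ∀ (n : ℕ) (φ : L.Formula (A ⊕ (Fin n × Fin m))) (s t : Fin n ↪o I),
    φ.Realize (Sum.elim (fun x : A => (x : M)) fun p => a (s p.1) p.2) ↔
      φ.Realize (Sum.elim (fun x : A => (x : M)) fun p => a (t p.1) p.2)

/-- Two sequences are mutually indiscernible over `A`: each is indiscernible over the union
of `A` and the other one. -/
def MutuallyIndiscernibleOver {I₁ I₂ : Type*} [LinearOrder I₁] [LinearOrder I₂] {m₁ m₂ : ℕ}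
    (A : Set M) (a₁ : I₁ → Fin m₁ → M) (a₂ : I₂ → Fin m₂ → M) : Prop :=
  IndiscernibleOver L (entries a₂ ∪ A) a₁ ∧ IndiscernibleOver L (entries a₁ ∪ A) a₂

/-- An end segment of a linear order: a nonempty upward closed subset. -/
def IsEndSegment {I : Type*} [LinearOrder I] (J : Set I) : Prop :=
  J.Nonempty ∧ IsUpperSet J

end Sequences

end NIPSeq

/-! Fix a parameter-free formula `φ`, to be evaluated at `b` and increasing tuples from both
sequences. If its truth value never stabilised, one could choose successive blocks, moving up both
orders at once, on which it holds exactly at even stages. Given a pattern `η` on `N` positions, take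
stage `2l` or `2l + 1` according to `η l`: on these blocks `b` realizes `η`. By mutual
indiscernibility some `x` realizes `η` on the first `N` blocks too, so `φ` shatters them for every
`N`, against NIP (`MutuallyIndiscernibleOver.exists_forall_realize_iff`). Hence each `φ` has a
threshold in each order. There are at most `|T|` such formulas, so by cofinality a single point of
each order lies above all its thresholds. -/

namespace NIPSeq

open FirstOrder.Language

section Order

variable {I : Type*} [LinearOrder I]

/-- The concatenation of `N` increasing `n`-tuples, each lying entirely below the next. -/
def concatEmb {N n : ℕ} (s : Fin N → Fin n ↪o I)
    (hs : ∀ l l', l < l' → ∀ j j', s l j < s l' j') : Fin (N * n) ↪o I :=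
  OrderEmbedding.ofStrictMono (fun r => s r.divNat r.modNat) <| by
    intro r r' hrr'
    have hle : r.divNat ≤ r'.divNat := Nat.div_le_div_right hrr'.le
    rcases hle.lt_or_eq with hlt | heq
    · exact hs _ _ hlt _ _
    · have hmod : r.modNat < r'.modNat := by
        have h1 := Nat.div_add_mod (r : ℕ) n
        have h2 := Nat.div_add_mod (r' : ℕ) n
        have h3 : (r : ℕ) / n = r' / n := congrArg Fin.val heq
        have h4 : (r : ℕ) < r' := hrr'
        change (r : ℕ) % n < r' % n
        rw [h3] at h1
        omega
      simpa only [heq] using (s r'.divNat).strictMono hmod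

theorem concatEmb_finProdFinEquiv {N n : ℕ} (s : Fin N → Fin n ↪o I)
    (hs : ∀ l l', l < l' → ∀ j j', s l j < s l' j') (l : Fin N) (j : Fin n) :
    concatEmb s hs (finProdFinEquiv (l, j)) = s l j := by
  have h := finProdFinEquiv.symm_apply_apply (l, j)
  rw [finProdFinEquiv_symm_apply, Prod.mk.injEq] at h
  change s (finProdFinEquiv (l, j)).divNat (finProdFinEquiv (l, j)).modNat = s l j
  rw [h.1, h.2]

theorem exists_forall_lt_of_finite [Nonempty I] [NoMaxOrder I] {ι : Type*} [Finite ι]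
    (f : ι → I) : ∃ x, ∀ i, f i < x := by
  obtain ⟨y, hy⟩ := Finite.exists_le f
  obtain ⟨x, hx⟩ := exists_gt y
  exact ⟨x, fun i => (hy i).trans_lt hx⟩

theorem forall_lt_of_forall_succ_lt {n : ℕ} {S : ℕ → Fin n ↪o I}
    (hS : ∀ i j j', S i j < S (i + 1) j') {i i' : ℕ} (h : i < i') (j j' : Fin n) :
    S i j < S i' j' := by
  induction i', h using Nat.le_induction generalizing j' with
  | base => exact hS i j j'
  | succ k _ ih => exact (ih j').trans (hS k j' j')

theorem exists_alternating {I₁ I₂ : Type*} [LinearOrder I₁] [LinearOrder I₂]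
    [Nonempty I₁] [Nonempty I₂] [NoMaxOrder I₁] [NoMaxOrder I₂] {n p : ℕ}
    (P : (Fin n ↪o I₁) → (Fin p ↪o I₂) → Prop)
    (hP : ∀ x y (v : Bool), ∃ s t, (∀ j, x ≤ s j) ∧ (∀ j, y ≤ t j) ∧ (P s t ↔ v = true)) :
    ∃ (S : ℕ → Fin n ↪o I₁) (T : ℕ → Fin p ↪o I₂),
      (∀ i i', i < i' → ∀ j j', S i j < S i' j') ∧
      (∀ i i', i < i' → ∀ j j', T i j < T i' j') ∧
      ∀ i, P (S i) (T i) ↔ Even i := by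
  choose s t hs ht hst using hP
  choose u₁ hu₁ using fun s : Fin n ↪o I₁ => exists_forall_lt_of_finite s
  choose u₂ hu₂ using fun t : Fin p ↪o I₂ => exists_forall_lt_of_finite t
  -- Lower bounds for stage `i`: each new bound lies strictly above the blocks just chosen.
  let pt : ℕ → I₁ × I₂ := fun i => Nat.rec (Classical.arbitrary I₁, Classical.arbitrary I₂)
    (fun i q => (u₁ (s q.1 q.2 (decide (Even i))), u₂ (t q.1 q.2 (decide (Even i))))) i
  refine ⟨fun i => s (pt i).1 (pt i).2 (decide (Even i)),
    fun i => t (pt i).1 (pt i).2 (decide (Even i)), ?_, ?_, fun i => ?_⟩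
  · intro i i' h
    exact forall_lt_of_forall_succ_lt
      (S := fun i => s (pt i).1 (pt i).2 (decide (Even i)))
      (fun i j j' => (hu₁ _ j).trans_le (hs (pt (i + 1)).1 (pt (i + 1)).2 _ j')) h
  · intro i i' h
    exact forall_lt_of_forall_succ_lt
      (S := fun i => t (pt i).1 (pt i).2 (decide (Even i)))
      (fun i j j' => (hu₂ _ j).trans_le (ht (pt (i + 1)).1 (pt (i + 1)).2 _ j')) h
  · simpa using hst (pt i).1 (pt i).2 (decide (Even i))

end Order

section Cofinality

theorem exists_forall_lt_of_lift_lt_cof {I : Type x} [LinearOrder I] {ι : Type w}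
    {c : Cardinal.{w}} (hι : #ι ≤ c)
    (hc : Cardinal.lift.{x} c < Cardinal.lift.{w} (Order.cof I)) (f : ι → I) :
    ∃ z, ∀ i, f i < z := by
  by_contra! h
  have hcof : IsCofinal (Set.range f) := fun z => by
    obtain ⟨i, hi⟩ := h z
    exact ⟨f i, ⟨i, rfl⟩, hi⟩
  have h1 : Cardinal.lift.{w} (Order.cof I) ≤ Cardinal.lift.{x} #ι :=
    (Cardinal.lift_le.2 (Order.cof_le hcof)).trans mk_range_le_lift
  exact absurd (hc.trans_le (h1.trans (Cardinal.lift_le.2 hι))) (lt_irrefl _)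

theorem mk_formula_le (L : FirstOrder.Language.{u, v}) (α : Type) [Countable α] :
    #(L.Formula α) ≤ max ℵ₀ L.card := by
  have h1 : #(L.Formula α) ≤ #(Σ n, L.BoundedFormula α n) :=
    Cardinal.mk_le_of_injective (f := Sigma.mk 0) sigma_mk_injective
  refine h1.trans (BoundedFormula.card_le.trans (max_le (le_max_left _ _) ?_))
  refine Cardinal.add_le_of_le (le_max_left _ _) ?_ ?_
  · exact (by simp : Cardinal.lift.{max u v} #α ≤ ℵ₀).trans (le_max_left _ _)
  · simp

theorem mk_sigma_formula_le (L : FirstOrder.Language.{u, v}) {ι : Type} [Countable ι]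
    (α : ι → Type) [∀ i, Countable (α i)] :
    #(Σ i, L.Formula (α i)) ≤ max ℵ₀ L.card := by
  rw [mk_sigma]
  refine (sum_le_sum _ (fun _ => max ℵ₀ L.card) fun i => mk_formula_le L (α i)).trans ?_
  rw [sum_const]
  refine Cardinal.mul_le_of_le (le_max_left _ _) ?_ ?_
  · exact (by simp : Cardinal.lift.{max u v} #ι ≤ ℵ₀).trans (le_max_left _ _)
  · simp

end Cofinality

section Sequences

variable {L : FirstOrder.Language.{u, v}} {M : Type w} [L.Structure M]

/-- The assignment of the tuples `a₁ ∘ s` and `a₂ ∘ t` to variables. -/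
def pairVal {I₁ I₂ : Type*} {m₁ m₂ n p : ℕ} (a₁ : I₁ → Fin m₁ → M) (a₂ : I₂ → Fin m₂ → M)
    (s : Fin n → I₁) (t : Fin p → I₂) : (Fin n × Fin m₁) ⊕ (Fin p × Fin m₂) → M :=
  Sum.elim (fun q => a₁ (s q.1) q.2) (fun q => a₂ (t q.1) q.2)

/-- By completeness, a shattering sentence that `T` does not prove is refuted by `T`, hence fails in
every model; no saturation of `M` is needed. -/
theorem exists_not_realize_ipSentence {T : L.Theory} (hT : T.IsComplete) (hNIP : IsNIP T)
    [Nonempty M] [M ⊨ T] {k m : ℕ} (φ : L.Formula (Fin k ⊕ Fin m)) :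
    ∃ n, ¬ M ⊨ ipSentence φ n := by
  by_contra! h
  refine hNIP ⟨k, m, φ, fun n => ?_⟩
  by_contra hn
  have := ((hT.models_not_iff _).2 hn).realize_sentence M
  exact (Sentence.realize_not M).1 this (h n)

theorem exists_not_shattered {T : L.Theory} (hT : T.IsComplete) (hNIP : IsNIP T)
    [Nonempty M] [M ⊨ T] {k : ℕ} {α : Type*} [Finite α] (φ : L.Formula (Fin k ⊕ α)) :
    ∃ n, ¬ ∃ y : Fin n → α → M, ∀ η : Fin n → Bool, ∃ x : Fin k → M,
        ∀ l : Fin n, φ.Realize (Sum.elim x (y l)) ↔ η l = true := by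
  obtain ⟨m, ⟨e⟩⟩ := Finite.exists_equiv_fin α
  obtain ⟨n, hn⟩ := exists_not_realize_ipSentence (M := M) hT hNIP (φ.relabel (Sum.map id e))
  refine ⟨n, fun ⟨y, hy⟩ => hn ((realize_ipSentence _ _).2 ⟨fun l => y l ∘ e.symm, fun η => ?_⟩)⟩
  obtain ⟨x, hx⟩ := hy η
  refine ⟨x, fun l => ?_⟩
  rw [Formula.realize_relabel, Sum.elim_comp_map, Function.comp_assoc, e.symm_comp_self]
  exact hx l

variable {I₁ I₂ : Type*} [LinearOrder I₁] [LinearOrder I₂] {m₁ m₂ : ℕ}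
  {a₁ : I₁ → Fin m₁ → M} {a₂ : I₂ → Fin m₂ → M}

/-- Move `s` to `s'` with the entries at `t` as parameters, then `t` to `t'` with the entries at
`s'` as parameters. -/
theorem MutuallyIndiscernibleOver.realize_iff {A : Set M}
    (h : MutuallyIndiscernibleOver L A a₁ a₂) {n p : ℕ}
    (ψ : L.Formula ((Fin n × Fin m₁) ⊕ (Fin p × Fin m₂)))
    (s s' : Fin n ↪o I₁) (t t' : Fin p ↪o I₂) :
    ψ.Realize (pairVal a₁ a₂ s t) ↔ ψ.Realize (pairVal a₁ a₂ s' t') := by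
  have e₁ := h.1 n (ψ.relabel (Sum.elim Sum.inr
    fun q => Sum.inl ⟨a₂ (t q.1) q.2, Or.inl ⟨_, _, rfl⟩⟩)) s s'
  have e₂ := h.2 p (ψ.relabel (Sum.elim
    (fun q => Sum.inl ⟨a₁ (s' q.1) q.2, Or.inl ⟨_, _, rfl⟩⟩) Sum.inr)) t t'
  simp only [Formula.realize_relabel, Sum.comp_elim] at e₁ e₂
  exact e₁.trans e₂

/-- A sequence is indiscernible over a second one and a tuple `b` as soon as the truth values of
formulas in `b` and increasing tuples from both do not depend on the tuples from the first. -/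
theorem indiscernibleOver_entries_union_range {k : ℕ} {b : Fin k → M}
    (h : ∀ (n p : ℕ) (ψ : L.Formula (Fin k ⊕ ((Fin n × Fin m₁) ⊕ (Fin p × Fin m₂))))
      (s s' : Fin n ↪o I₁) (t : Fin p ↪o I₂),
      ψ.Realize (Sum.elim b (pairVal a₁ a₂ s t)) ↔
        ψ.Realize (Sum.elim b (pairVal a₁ a₂ s' t))) :
    IndiscernibleOver L (entries a₂ ∪ Set.range b) a₁ := by
  classical
  intro n φ s s'
  have hA : ∀ x : ↥(entries a₂ ∪ Set.range b),
      ∃ F : Finset I₂, (∃ i ∈ F, ∃ j, a₂ i j = x) ∨ ∃ j, b j = x := by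
    rintro ⟨x, ⟨i, j, hx⟩ | hx⟩
    · exact ⟨{i}, Or.inl ⟨i, by simp, j, hx⟩⟩
    · exact ⟨∅, Or.inr hx⟩
  choose F hF using hA
  -- Only finitely many parameters occur in `φ`. Listing their indices in `I₂` increasingly turns
  -- those outside `b` into coordinates of one increasing tuple `t`.
  let G : Finset I₂ := φ.freeVarFinset.biUnion (Sum.elim F fun _ => ∅)
  let t : Fin G.card ↪o I₂ := G.orderEmbOfFin rfl
  have hval : ∀ c : φ.freeVarFinset,
      ∃ d : Fin k ⊕ ((Fin n × Fin m₁) ⊕ (Fin G.card × Fin m₂)), ∀ r : Fin n ↪o I₁,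
        Sum.elim b (pairVal a₁ a₂ r t) d =
          Sum.elim (fun x : ↥(entries a₂ ∪ Set.range b) => (x : M))
            (fun q => a₁ (r q.1) q.2) (c : _ ⊕ (Fin n × Fin m₁)) := by
    rintro ⟨x | q, hc⟩
    · rcases hF x with ⟨i, hi, j, hij⟩ | ⟨j, hj⟩
      · have hiG : i ∈ Set.range t := by
          rw [Finset.range_orderEmbOfFin]
          exact Finset.mem_biUnion.2 ⟨_, hc, hi⟩
        obtain ⟨l, rfl⟩ := hiG
        exact ⟨Sum.inr (Sum.inr (l, j)), fun _ => hij⟩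
      · exact ⟨Sum.inl j, fun _ => hj⟩
    · exact ⟨Sum.inr (Sum.inl q), fun _ => rfl⟩
  choose d hd using hval
  have key : ∀ r : Fin n ↪o I₁,
      Formula.Realize (BoundedFormula.restrictFreeVar φ d) (Sum.elim b (pairVal a₁ a₂ r t)) ↔
        φ.Realize (Sum.elim (fun x : ↥(entries a₂ ∪ Set.range b) => (x : M))
          fun q => a₁ (r q.1) q.2) :=
    fun r => BoundedFormula.realize_restrictFreeVar _ fun c => hd c r
  rw [← key s, ← key s']
  exact h _ _ _ s s' t

theorem mutuallyIndiscernibleOver_range {k : ℕ} {b : Fin k → M}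
    (h : ∀ (n p : ℕ) (ψ : L.Formula (Fin k ⊕ ((Fin n × Fin m₁) ⊕ (Fin p × Fin m₂))))
      (s s' : Fin n ↪o I₁) (t t' : Fin p ↪o I₂),
      ψ.Realize (Sum.elim b (pairVal a₁ a₂ s t)) ↔
        ψ.Realize (Sum.elim b (pairVal a₁ a₂ s' t'))) :
    MutuallyIndiscernibleOver L (Set.range b) a₁ a₂ := by
  refine ⟨indiscernibleOver_entries_union_range fun n p ψ s s' t => h n p ψ s s' t t,
    indiscernibleOver_entries_union_range fun n p ψ s s' t => ?_⟩
  have := h p n (ψ.relabel (Sum.map id Sum.swap)) t t s s'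
  simpa only [Formula.realize_relabel, Sum.elim_comp_map, Function.comp_id, pairVal,
    Sum.elim_swap] using this

/-- The formula saying that some `x` satisfies the `l`-th copy of `φ` exactly when `η l` holds,
for all `l < N`, the copies being evaluated at consecutive blocks of variables. -/
noncomputable def patternFormula {k n p N : ℕ}
    (φ : L.Formula (Fin k ⊕ ((Fin n × Fin m₁) ⊕ (Fin p × Fin m₂)))) (η : Fin N → Bool) :
    L.Formula ((Fin (N * n) × Fin m₁) ⊕ (Fin (N * p) × Fin m₂)) :=
  let inst (l : Fin N) :
      L.Formula (((Fin (N * n) × Fin m₁) ⊕ (Fin (N * p) × Fin m₂)) ⊕ Fin k) :=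
    φ.relabel (Sum.elim Sum.inr fun q => Sum.inl <|
      Sum.map (Prod.map (fun j => finProdFinEquiv (l, j)) id)
        (Prod.map (fun j => finProdFinEquiv (l, j)) id) q)
  Formula.iExs (Fin k) <|
    Formula.iInf fun l : Fin N => if η l then inst l else (inst l).not

theorem realize_patternFormula {k n p N : ℕ}
    (φ : L.Formula (Fin k ⊕ ((Fin n × Fin m₁) ⊕ (Fin p × Fin m₂)))) (η : Fin N → Bool)
    (s : Fin N → Fin n ↪o I₁) (hs : ∀ l l', l < l' → ∀ j j', s l j < s l' j')
    (t : Fin N → Fin p ↪o I₂) (ht : ∀ l l', l < l' → ∀ j j', t l j < t l' j') :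
    (patternFormula φ η).Realize (pairVal a₁ a₂ (concatEmb s hs) (concatEmb t ht)) ↔
      ∃ x : Fin k → M, ∀ l, φ.Realize (Sum.elim x (pairVal a₁ a₂ (s l) (t l))) ↔ η l = true := by
  have hval (x : Fin k → M) (l : Fin N) :
      Sum.elim (pairVal a₁ a₂ (concatEmb s hs) (concatEmb t ht)) x ∘
        (Sum.elim Sum.inr fun q => Sum.inl <|
          Sum.map (Prod.map (fun j => finProdFinEquiv (l, j)) id)
            (Prod.map (fun j => finProdFinEquiv (l, j)) id) q) =
      Sum.elim x (pairVal a₁ a₂ (s l) (t l)) := by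
    funext c
    rcases c with c | c | c
    · rfl
    · exact congrArg (fun i => a₁ i c.2) (concatEmb_finProdFinEquiv s hs l c.1)
    · exact congrArg (fun i => a₂ i c.2) (concatEmb_finProdFinEquiv t ht l c.1)
  simp only [patternFormula, Formula.realize_iExs, Formula.realize_iInf]
  refine exists_congr fun x => forall_congr' fun l => ?_
  cases h : η l
  · simp only [Bool.false_eq_true, if_false, Formula.realize_not, Formula.realize_relabel, hval,
      iff_false]
  · simp only [if_true, Formula.realize_relabel, hval, iff_true]

/-- Under NIP, a formula with parameters `b` has constant truth value on increasing tuples taken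
from sufficiently late parts of two mutually indiscernible sequences. -/
theorem MutuallyIndiscernibleOver.exists_forall_realize_iff {T : L.Theory} (hT : T.IsComplete)
    (hNIP : IsNIP T) [Nonempty M] [M ⊨ T] [Nonempty I₁] [Nonempty I₂]
    [NoMaxOrder I₁] [NoMaxOrder I₂] {A : Set M} (h : MutuallyIndiscernibleOver L A a₁ a₂)
    {k : ℕ} (b : Fin k → M) {n p : ℕ}
    (φ : L.Formula (Fin k ⊕ ((Fin n × Fin m₁) ⊕ (Fin p × Fin m₂)))) :
    ∃ (x : I₁) (y : I₂), ∀ (s s' : Fin n ↪o I₁) (t t' : Fin p ↪o I₂),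
      (∀ j, x ≤ s j) → (∀ j, x ≤ s' j) → (∀ j, y ≤ t j) → (∀ j, y ≤ t' j) →
      (φ.Realize (Sum.elim b (pairVal a₁ a₂ s t)) ↔
        φ.Realize (Sum.elim b (pairVal a₁ a₂ s' t'))) := by
  by_contra hcon
  have hboth : ∀ x y (v : Bool), ∃ (s : Fin n ↪o I₁) (t : Fin p ↪o I₂),
      (∀ j, x ≤ s j) ∧ (∀ j, y ≤ t j) ∧
        (φ.Realize (Sum.elim b (pairVal a₁ a₂ s t)) ↔ v = true) := by
    intro x y v
    -- If the value `v` were not attained above `x` and `y`, the formula would be constant there.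
    by_contra! hv
    refine hcon ⟨x, y, fun s s' t t' hs hs' ht ht' => ?_⟩
    have h1 := hv s t hs ht
    have h2 := hv s' t' hs' ht'
    cases v <;> simp_all
  obtain ⟨S, R, hS, hR, hSR⟩ := exists_alternating _ hboth
  obtain ⟨N, hN⟩ := exists_not_shattered (M := M) hT hNIP φ
  refine hN ⟨fun l => pairVal a₁ a₂ (S l) (R l), fun η => ?_⟩
  let f : Fin N → ℕ := fun l => 2 * l + (if η l then 0 else 1)
  have hf : ∀ l l', l < l' → f l < f l' := by
    intro l l' hl
    have hl' : (l : ℕ) < l' := hl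
    dsimp only [f]
    split_ifs <;> omega
  have hfη : ∀ l, Even (f l) ↔ η l = true := by
    intro l
    cases hl : η l <;> simp [f, hl, parity_simps]
  -- The existence of a realization of `η` is a formula about the concatenated blocks, so it
  -- transfers from the stages `f l`, where `b` is a witness.
  rw [← realize_patternFormula φ η (fun l => S l) (fun l l' hl => hS l l' hl)
    (fun l => R l) (fun l l' hl => hR l l' hl),
    h.realize_iff _ _ (concatEmb (fun l => S (f l)) fun l l' hl => hS _ _ (hf l l' hl)) _
      (concatEmb (fun l => R (f l)) fun l l' hl => hR _ _ (hf l l' hl)),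
    realize_patternFormula]
  exact ⟨b, fun l => (hSR (f l)).trans (hfη l)⟩

end Sequences

theorem isEndSegment_Ici {I : Type*} [LinearOrder I] (x : I) : IsEndSegment (Set.Ici x) :=
  ⟨Set.nonempty_Ici, isUpperSet_Ici x⟩

end NIPSeq

theorem claim4p5
    {L : FirstOrder.Language.{u, v}} (T : L.Theory) (hT : T.IsComplete) (hNIP : NIPSeq.IsNIP T)
    {M : Type w} [L.Structure M] [Nonempty M] [M ⊨ T]
    {I₁ : Type x} {I₂ : Type y} [LinearOrder I₁] [LinearOrder I₂] [NoMaxOrder I₁] [NoMaxOrder I₂]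
    (hcof₁ : Cardinal.lift.{x} (NIPSeq.theoryCard T) < Cardinal.lift.{max u v} (Order.cof I₁))
    (hcof₂ : Cardinal.lift.{y} (NIPSeq.theoryCard T) < Cardinal.lift.{max u v} (Order.cof I₂))
    {m₁ m₂ : ℕ} (a₁ : I₁ → Fin m₁ → M) (a₂ : I₂ → Fin m₂ → M)
    (hmut : NIPSeq.MutuallyIndiscernibleOver L ∅ a₁ a₂)
    {k : ℕ} (b : Fin k → M) :
    ∃ (J₁ : Set I₁) (J₂ : Set I₂), NIPSeq.IsEndSegment J₁ ∧ NIPSeq.IsEndSegment J₂ ∧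
      NIPSeq.MutuallyIndiscernibleOver L (Set.range b)
        (fun t : J₁ => a₁ t) (fun t : J₂ => a₂ t) := by
  have : Nonempty I₁ := by
    by_contra hI
    rw [not_nonempty_iff] at hI
    simp at hcof₁
  have : Nonempty I₂ := by
    by_contra hI
    rw [not_nonempty_iff] at hI
    simp at hcof₂
  -- Entries of the sequences enter only through `s` and `t`, so thresholds are indexed by
  -- parameter-free formulas, however long the sequences are.
  choose x y hxy using fun φ : Σ i : ℕ × ℕ,
      L.Formula (Fin k ⊕ ((Fin i.1 × Fin m₁) ⊕ (Fin i.2 × Fin m₂))) =>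
    hmut.exists_forall_realize_iff hT hNIP b φ.2
  have hcard := NIPSeq.mk_sigma_formula_le L
    fun i : ℕ × ℕ => Fin k ⊕ ((Fin i.1 × Fin m₁) ⊕ (Fin i.2 × Fin m₂))
  obtain ⟨z₁, hz₁⟩ := NIPSeq.exists_forall_lt_of_lift_lt_cof hcard hcof₁ x
  obtain ⟨z₂, hz₂⟩ := NIPSeq.exists_forall_lt_of_lift_lt_cof hcard hcof₂ y
  refine ⟨Set.Ici z₁, Set.Ici z₂, NIPSeq.isEndSegment_Ici z₁, NIPSeq.isEndSegment_Ici z₂,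
    NIPSeq.mutuallyIndiscernibleOver_range fun n p ψ s s' t t' => ?_⟩
  have le₁ (r : Fin n ↪o Set.Ici z₁) (j : Fin n) : x ⟨(n, p), ψ⟩ ≤ r j :=
    (hz₁ _).le.trans (r j).2
  have le₂ (r : Fin p ↪o Set.Ici z₂) (j : Fin p) : y ⟨(n, p), ψ⟩ ≤ r j :=
    (hz₂ _).le.trans (r j).2
  exact hxy ⟨(n, p), ψ⟩ (s.trans (OrderEmbedding.subtype _)) (s'.trans (OrderEmbedding.subtype _))
    (t.trans (OrderEmbedding.subtype _)) (t'.trans (OrderEmbedding.subtype _))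
    (le₁ s) (le₁ s') (le₂ t) (le₂ t')
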